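/- Graphs are finite undirected multigraphs. The chromatic polynomial of a graph $G=(V,E)$ is $P_G(q)=\sum_{F\subseteq E}(-1)^{|F|}q^{k(F)}$, where $k(F)$ is the number of connected components of $(V,F)$; for every integer $q\ge 0$ its value is the number of proper $q$-colourings of $G$. The complex zeros of $P_G$ are the chromatic roots of $G$. For integers $s,p\ge 1$, the generalized theta graph $\Theta^{(s,p)}$ consists of two end vertices $x\neq y$ joined by $p$ internally disjoint paths, each with $s$ edges. Theorem 1.1. The generalized theta graphs $\Theta^{(s,p)}$, $s,p\ge 1$, form a countably infinite family of pairwise non-isomorphic finite graphs. Each of them is planar and, with terminals $x,y$, is a two-terminal series-parallel graph (it is built from single edges by series and parallel connections). Their chromatic roots, taken together, are dense in the complex plane with the possible exception of the disc $|q-1|<1$: for every $q_0\in\mathbb C$ with $|q_0-1|\ge 1$ and every $\varepsilon>0$ there are $s,p\ge 1$ and a chromatic root $q$ of $\Theta^{(s,p)}$ with $|q-q_0|<\varepsilon$. -/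

import Mathlib

open Polynomial

/-! Graphs are Mathlib's multigraphs `Graph α β` (loops and multiple edges allowed),
with vertex set `V(G) : Set α` and edge set `E(G) : Set β`. -/

namespace Graph

/-! ### The chromatic polynomial -/

/-- The number `k(F)` of connected components (isolated vertices included) of the graph
`(V(G), F)`: the number of classes of `V(G)` under the equivalence relation generated by
joining the two ends of each edge in `F`. -/
noncomputable def numComponents {α β : Type*} (G : Graph α β) (F : Set β) : ℕ :=
  Nat.card (Quot fun u v : V(G) => ∃ e ∈ F, G.IsLink e u v)

/-- The chromatic polynomial of a finite graph, `P_G(X) = ∑_{F ⊆ E(G)} (-1)^|F| X^{k(F)}`.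
That it counts the proper colourings is `chromaticPolynomial_eval_natCast` below. -/
noncomputable def chromaticPolynomial {α β : Type*} (G : Graph α β) : ℤ[X] :=
  ∑ᶠ (F : Set β) (_ : F ⊆ E(G)), (-1) ^ F.ncard * X ^ G.numComponents F

/-- Proper `k`-colourings: the ends of every edge get different colours. -/
def ProperColoring {α β : Type*} (G : Graph α β) (k : ℕ) : Type _ :=
  {c : V(G) → Fin k // ∀ (e : β) (u v : V(G)), G.IsLink e u v → c u ≠ c v}

/-- The complex zeros of the chromatic polynomial. -/
def chromaticRoots {α β : Type*} (G : Graph α β) : Set ℂ :=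
  {q | aeval q G.chromaticPolynomial = 0}

/-- Colourings that are constant along the edges of `F` are colourings of the components. -/
theorem natCard_constant_colorings {α β : Type*} (G : Graph α β) (hV : V(G).Finite)
    (F : Set β) (k : ℕ) :
    Nat.card {c : V(G) → Fin k // ∀ e ∈ F, ∀ u v : V(G), G.IsLink e u v → c u = c v} =
      k ^ G.numComponents F := by
  have := hV.to_subtype
  have e : {c : V(G) → Fin k // ∀ e ∈ F, ∀ u v : V(G), G.IsLink e u v → c u = c v} ≃
      (Quot (fun u v : V(G) => ∃ e ∈ F, G.IsLink e u v) → Fin k) :=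
    { toFun := fun c => Quot.lift c.1 (fun u v ⟨e, he, h⟩ => c.2 e he u v h)
      invFun := fun d => ⟨fun u => d (Quot.mk _ u),
        fun e he u v h => congrArg d (Quot.sound ⟨e, he, h⟩)⟩
      left_inv := fun c => rfl
      right_inv := fun d => by
        funext x
        induction x using Quot.ind
        rfl }
  rw [Nat.card_congr e, Nat.card_fun, Nat.card_fin, numComponents]

/-- The value of the chromatic polynomial of a finite graph at a natural number `k` is the
number of its proper `k`-colourings. -/
theorem chromaticPolynomial_eval_natCast {α β : Type*} (G : Graph α β) (hV : V(G).Finite)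
    (hE : E(G).Finite) (k : ℕ) :
    G.chromaticPolynomial.eval (k : ℤ) = Nat.card (G.ProperColoring k) := by
  classical
  have := hV.to_subtype
  have := Fintype.ofFinite V(G)
  have h1 : G.chromaticPolynomial = ∑ F ∈ hE.toFinset.powerset,
      (-1 : ℤ[X]) ^ F.card * X ^ G.numComponents (F : Set β) := by
    rw [chromaticPolynomial]
    have hfin : {F : Set β | F ⊆ E(G)}.Finite := hE.finite_subsets
    have h2 := finsum_mem_eq_finite_toFinset_sum
      (fun F : Set β => (-1 : ℤ[X]) ^ F.ncard * X ^ G.numComponents F) hfin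
    refine h2.trans ?_
    symm
    refine Finset.sum_bij (fun F _ => (F : Set β)) ?_ ?_ ?_ ?_
    · intro F hF
      simpa using hF
    · intro F _ F' _ h
      exact_mod_cast h
    · intro F hF
      have hF' : F ⊆ E(G) := by simpa using hF
      refine ⟨(hE.subset hF').toFinset, ?_, by simp⟩
      simpa using hF'
    · intro F _
      rw [Set.ncard_coe_finset]
  let M : (V(G) → Fin k) → Finset β := fun c =>
    {e ∈ hE.toFinset | ∀ u v : V(G), G.IsLink e u v → c u = c v}
  have h3 : ∀ F ∈ hE.toFinset.powerset, ((k : ℤ) ^ G.numComponents (F : Set β)) =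
      ∑ c : V(G) → Fin k, if F ⊆ M c then 1 else 0 := by
    intro F hF
    have h4 := G.natCard_constant_colorings hV (F : Set β) k
    rw [Nat.card_eq_fintype_card, Fintype.card_subtype] at h4
    rw [Finset.sum_boole, ← Nat.cast_pow, ← h4]
    congr 2
    ext c
    simp only [Finset.mem_filter, Finset.mem_univ, true_and, M, Finset.subset_iff]
    constructor
    · intro h e he
      exact ⟨Finset.mem_powerset.1 hF he, h e he⟩
    · intro h e he
      exact (h he).2
  have h5 : ∀ c : V(G) → Fin k,
      (∑ F ∈ hE.toFinset.powerset, (-1 : ℤ) ^ F.card * if F ⊆ M c then 1 else 0) =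
        if M c = ∅ then 1 else 0 := by
    intro c
    rw [← Finset.sum_powerset_neg_one_pow_card (x := M c)]
    simp only [mul_ite, mul_one, mul_zero]
    rw [← Finset.sum_filter]
    refine Finset.sum_congr ?_ fun _ _ => rfl
    ext F
    simp only [Finset.mem_filter, Finset.mem_powerset]
    exact ⟨fun h => h.2, fun h => ⟨h.trans (Finset.filter_subset _ _), h⟩⟩
  have h6 : Nat.card (G.ProperColoring k) =
      (Finset.univ.filter fun c : V(G) → Fin k => M c = ∅).card := by
    rw [← Fintype.card_subtype, ← Nat.card_eq_fintype_card]
    refine Nat.card_congr (Equiv.subtypeEquivRight fun c => ?_)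
    simp only [M, Finset.filter_eq_empty_iff, Set.Finite.mem_toFinset]
    constructor
    · intro h e he hc
      obtain ⟨u, v, huv⟩ := G.exists_isLink_of_mem_edgeSet he
      exact h e ⟨u, huv.left_mem⟩ ⟨v, huv.right_mem⟩ huv (hc _ _ huv)
    · intro h e u v huv hc
      refine h huv.edge_mem fun u' v' huv' => ?_
      rcases huv.eq_and_eq_or_eq_and_eq huv' with ⟨h1, h2⟩ | ⟨h1, h2⟩
      · rw [← Subtype.ext h1, ← Subtype.ext h2, hc]
      · rw [← Subtype.ext h1, ← Subtype.ext h2, hc]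
  rw [h1, eval_finsetSum, h6]
  simp only [eval_mul, eval_pow, eval_neg, eval_one, eval_X]
  rw [Finset.sum_congr rfl fun F hF => by rw [h3 F hF, Finset.mul_sum], Finset.sum_comm,
    Finset.sum_congr rfl fun c _ => h5 c, Finset.sum_boole]

/-! ### Series-parallel and planar graphs, isomorphism -/

/-- `G` is the union of its subgraphs `H` and `K`, which have no edge in common. -/
structure IsEdgeDisjointUnion {α β : Type*} (G H K : Graph α β) : Prop where
  left_le : H ≤ G
  right_le : K ≤ G
  vertexSet_eq : V(G) = V(H) ∪ V(K)
  edgeSet_eq : E(G) = E(H) ∪ E(K)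
  disjoint : Disjoint E(H) E(K)

/-- Two-terminal series-parallel graphs `(G, x, y)`: those built from single edges (with
distinct ends as terminals) by parallel connection (identifying both pairs of terminals) and
series connection (identifying the second terminal of one graph with the first one of
the other). -/
inductive IsSeriesParallel {α β : Type*} : Graph α β → α → α → Prop
  | edge (x y : α) (e : β) (hxy : x ≠ y) :
      IsSeriesParallel (Graph.banana x y {e}) x y
  | parallel (G H K : Graph α β) (x y : α) (hG : G.IsEdgeDisjointUnion H K)
      (hV : V(H) ∩ V(K) = {x, y})
      (hH : IsSeriesParallel H x y) (hK : IsSeriesParallel K x y) :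
      IsSeriesParallel G x y
  | series (G H K : Graph α β) (x z y : α) (hG : G.IsEdgeDisjointUnion H K)
      (hV : V(H) ∩ V(K) = {z})
      (hH : IsSeriesParallel H x z) (hK : IsSeriesParallel K z y) :
      IsSeriesParallel G x y

/-- `G` can be drawn in the plane without crossings: vertices are distinct points, each edge
is a curve joining its ends, and the open edges (the curves without their end points) are
simple, pairwise disjoint, and avoid all vertices. -/
def IsPlanar {α β : Type*} (G : Graph α β) : Prop :=
  ∃ (pt : α → ℝ × ℝ) (arc : β → ℝ → ℝ × ℝ),
    Set.InjOn pt V(G) ∧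
    (∀ e ∈ E(G), ContinuousOn (arc e) (Set.Icc 0 1)) ∧
    (∀ e u v, G.IsLink e u v → s(arc e 0, arc e 1) = s(pt u, pt v)) ∧
    (∀ e ∈ E(G), Set.InjOn (arc e) (Set.Ioo 0 1)) ∧
    (∀ e ∈ E(G), Disjoint (arc e '' Set.Ioo 0 1) (pt '' V(G))) ∧
    (∀ e ∈ E(G), ∀ f ∈ E(G), e ≠ f →
      Disjoint (arc e '' Set.Ioo 0 1) (arc f '' Set.Ioo 0 1))

/-- Isomorphism of multigraphs. -/
def Isomorphic {α β α' β' : Type*} (G : Graph α β) (H : Graph α' β') : Prop :=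
  ∃ (f : V(G) ≃ V(H)) (g : E(G) ≃ E(H)),
    ∀ (e : E(G)) (u v : V(G)), G.IsLink e u v ↔ H.IsLink (g e) (f u) (f v)

/-! ### Generalized theta graphs -/

/-- Labels for the vertices of theta graphs: the two end vertices, and the interior vertices
`inner i j` (the `j`-th vertex on the `i`-th path). -/
inductive ThetaVertex
  | left
  | right
  | inner (i j : ℕ)

/-- The `j`-th vertex, `0 ≤ j ≤ s`, on the `i`-th path of length `s` from `left` to `right`. -/
def thetaNode (s i j : ℕ) : ThetaVertex :=
  if j = 0 then .left else if j = s then .right else .inner i j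

/-- The generalized theta graph `Θ^{(s,p)}` (for `s, p ≥ 1`): the end vertices `left` and
`right` joined by `p` internally disjoint paths, indexed by `i < p`, each consisting of `s`
edges in series. The edge `(i, j)`, `j < s`, joins the `j`-th and the `(j+1)`-st vertex on
the `i`-th path. -/
def theta (s p : ℕ) : Graph ThetaVertex (ℕ × ℕ) where
  vertexSet := {.left, .right} ∪ {w | ∃ i j, i < p ∧ 0 < j ∧ j < s ∧ w = .inner i j}
  edgeSet := {e | e.1 < p ∧ e.2 < s}
  IsLink e u v := e.1 < p ∧ e.2 < s ∧ s(u, v) = s(thetaNode s e.1 e.2, thetaNode s e.1 (e.2 + 1))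
  isLink_symm := fun e _ => ⟨fun u v ⟨h1, h2, h3⟩ => ⟨h1, h2, by rw [Sym2.eq_swap, h3]⟩⟩
  eq_or_eq_of_isLink_of_isLink := by
    rintro e x y v w ⟨_, _, h⟩ ⟨_, _, h'⟩
    have := h.trans h'.symm
    rw [Sym2.eq_iff] at this
    tauto
  edge_mem_iff_exists_isLink := fun e =>
    ⟨fun h => ⟨_, _, h.1, h.2, rfl⟩, fun ⟨_, _, h1, h2, _⟩ => ⟨h1, h2⟩⟩
  left_mem_of_isLink := by
    rintro ⟨i, j⟩ x y ⟨hi, hj, h⟩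
    dsimp only at hi hj h
    have key : ∀ m ≤ s, thetaNode s i m ∈ ({.left, .right} : Set ThetaVertex) ∪
        {w | ∃ i j, i < p ∧ 0 < j ∧ j < s ∧ w = .inner i j} := by
      intro m hm
      unfold thetaNode
      split_ifs with h0 hs
      · simp
      · simp
      · exact Or.inr ⟨i, m, hi, by omega, by omega, rfl⟩
    rw [Sym2.eq_iff] at h
    rcases h with ⟨rfl, _⟩ | ⟨rfl, _⟩
    · exact key _ (by omega)
    · exact key _ (by omega)

end Graph

/-!
The `p` paths of `Θ^{(s,p)}` are coloured independently once the colours of the two ends are fixed,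
so that `X^p P(X) = X (((X-1)^s + (-1)^s (X-1))^p + (X-1) ((X-1)^s - (-1)^s)^p)`. With `w = 1 - q`
the chromatic roots therefore include the solutions `w ≠ 1` of `(w^s - w)^p = w (w^s - 1)^p`. Put
`w = e^z`: taking a `p`-th root, it suffices that `e^{sz} - e^z = e^{z/p} (e^{sz} - 1)`, that is,
`e^{sz} = 1 + (1 - e^z) / (e^{z/p} - 1)`. As `p → ∞` the right-hand side divided by `p` converges
to `(1 - e^z) / z`, so the equation reads `s z = log p + O(1)`. Near a point `z₀` with positive
real part, and for a suitable branch of the logarithm, the choice `p = ⌈e^{s Re z₀}⌉` makes it a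
perturbation `z = z₀ + O(1/s)` of the equation `z = z₀`, which is solvable by the minimum modulus
principle. Finally, `Re z > 0` amounts to `|q - 1| > 1`.
-/

section Analysis

open Filter Metric Set Topology

lemma exists_eq_zero_of_norm_lt_of_le_norm_frontier {E : Type*} [NormedAddCommGroup E]
    [NormedSpace ℂ E] [Nontrivial E] {f : E → ℂ} {U : Set E} {z₀ : E} {m : ℝ}
    (hU : Bornology.IsBounded U) (hf : DiffContOnCl ℂ f U) (hm : ∀ z ∈ frontier U, m ≤ ‖f z‖)
    (hz₀ : z₀ ∈ U) (hlt : ‖f z₀‖ < m) : ∃ z ∈ U, f z = 0 := by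
  by_contra! hne
  have hm0 : 0 < m := (norm_nonneg _).trans_lt hlt
  have hne' : ∀ z ∈ closure U, f z ≠ 0 := by
    rw [closure_eq_self_union_frontier]
    rintro z (hz | hz)
    · exact hne z hz
    · exact norm_pos_iff.1 (hm0.trans_le (hm z hz))
  have hle : ‖(f z₀)⁻¹‖ ≤ m⁻¹ :=
    Complex.norm_le_of_forall_mem_frontier_norm_le hU (hf.inv hne')
      (fun z hz => by simpa using inv_anti₀ hm0 (hm z hz)) (subset_closure hz₀)
  rw [norm_inv] at hle
  exact hlt.not_ge ((inv_le_inv₀ (norm_pos_iff.2 (hne z₀ hz₀)) hm0).1 hle)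

lemma exists_mem_ball_add_eq {g : ℂ → ℂ} {z₀ a : ℂ} {r M : ℝ}
    (hg : DiffContOnCl ℂ g (ball z₀ r)) (hM : ∀ z ∈ closedBall z₀ r, ‖g z‖ ≤ M)
    (hr : 0 < r) (har : 2 * (‖a - z₀‖ + M) < r) : ∃ z ∈ ball z₀ r, z + g z = a := by
  have hf : DiffContOnCl ℂ (fun z => z + g z - a) (ball z₀ r) :=
    (differentiable_id.diffContOnCl.add hg).sub_const a
  have hsphere : ∀ z ∈ frontier (ball z₀ r), r - (‖a - z₀‖ + M) ≤ ‖z + g z - a‖ := by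
    intro z hz
    rw [frontier_ball z₀ hr.ne'] at hz
    calc r - (‖a - z₀‖ + M) ≤ ‖z - z₀‖ - (‖a - z₀‖ + ‖g z‖) := by
          rw [mem_sphere_iff_norm.1 hz]
          linarith [hM z (sphere_subset_closedBall hz)]
      _ ≤ ‖z - z₀‖ - ‖a - z₀ - g z‖ := by linarith [norm_sub_le (a - z₀) (g z)]
      _ ≤ ‖z - z₀ - (a - z₀ - g z)‖ := norm_sub_norm_le _ _
      _ = ‖z + g z - a‖ := by ring_nf
  have hcenter : ‖z₀ + g z₀ - a‖ < r - (‖a - z₀‖ + M) :=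
    calc ‖z₀ + g z₀ - a‖ = ‖g z₀ - (a - z₀)‖ := by ring_nf
      _ ≤ ‖g z₀‖ + ‖a - z₀‖ := norm_sub_le _ _
      _ < r - (‖a - z₀‖ + M) := by linarith [hM z₀ (mem_closedBall_self hr.le)]
  obtain ⟨z, hz, hz0⟩ := exists_eq_zero_of_norm_lt_of_le_norm_frontier isBounded_ball hf hsphere
    (mem_ball_self hr) hcenter
  exact ⟨z, hz, sub_eq_zero.1 hz0⟩

lemma exists_exp_eq_natCeil_exp_re {ζ : ℂ} (hζ : 0 ≤ ζ.re) :
    ∃ b : ℂ, Complex.exp b = ⌈Real.exp ζ.re⌉₊ ∧ ‖b - ζ‖ ≤ 5 := by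
  set n : ℕ := ⌈Real.exp ζ.re⌉₊
  have hn : (0 : ℝ) < n := (Real.exp_pos _).trans_le (Nat.le_ceil _)
  set w : ℂ := n * Complex.exp (-ζ) with hw
  have hw0 : w ≠ 0 := mul_ne_zero (by exact_mod_cast hn.ne') (Complex.exp_ne_zero _)
  have hnorm : ‖w‖ = n / Real.exp ζ.re := by
    rw [hw, norm_mul, Complex.norm_natCast, Complex.norm_exp, Complex.neg_re, Real.exp_neg,
      div_eq_mul_inv]
  have hnorm_ge : 1 ≤ ‖w‖ := by
    rw [hnorm, one_le_div (Real.exp_pos _)]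
    exact Nat.le_ceil _
  have hnorm_le : ‖w‖ ≤ 2 := by
    rw [hnorm, div_le_iff₀ (Real.exp_pos _)]
    linarith [Nat.ceil_lt_add_one (Real.exp_pos ζ.re).le, Real.one_le_exp hζ]
  refine ⟨ζ + Complex.log w, ?_, ?_⟩
  · rw [Complex.exp_add, Complex.exp_log hw0, hw, mul_left_comm, ← Complex.exp_add,
      add_neg_cancel, Complex.exp_zero, mul_one]
  · calc ‖ζ + Complex.log w - ζ‖ ≤ |(Complex.log w).re| + |(Complex.log w).im| := by
          rw [add_sub_cancel_left]
          exact Complex.norm_le_abs_re_add_abs_im _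
      _ = Real.log ‖w‖ + |w.arg| := by
          rw [Complex.log_re, Complex.log_im, abs_of_nonneg (Real.log_nonneg hnorm_ge)]
      _ ≤ 1 + 4 := by
          refine add_le_add ?_ (w.abs_arg_le_pi.trans Real.pi_lt_four.le)
          linarith [Real.log_le_sub_one_of_pos (one_pos.trans_le hnorm_ge)]
      _ = 5 := by norm_num

lemma exists_analyticAt_exp_eventuallyEq {E : Type*} [NormedAddCommGroup E] [NormedSpace ℂ E]
    {K : E → ℂ} {x₀ : E} (hK : AnalyticAt ℂ K x₀) (hK₀ : K x₀ ≠ 0) :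
    ∃ L : E → ℂ, AnalyticAt ℂ L x₀ ∧ ∀ᶠ x in 𝓝 x₀, Complex.exp (L x) = K x := by
  refine ⟨fun x => Complex.log (K x₀) + Complex.log (K x / K x₀), ?_, ?_⟩
  · refine analyticAt_const.add ((hK.div analyticAt_const hK₀).clog ?_)
    rw [Pi.div_apply, div_self hK₀]
    exact Complex.one_mem_slitPlane
  · filter_upwards [hK.continuousAt.eventually_ne hK₀] with x hx
    rw [Complex.exp_add, Complex.exp_log hK₀, Complex.exp_log (div_ne_zero hx hK₀),
      mul_div_cancel₀ _ hK₀]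

lemma exists_exp_mul_eq_natCast_mul_exp {s p : ℕ} {L : ℂ → ℂ} {z₀ : ℂ} {r M : ℝ}
    (hz₀ : 0 ≤ z₀.re) (hp : p = ⌈Real.exp (s * z₀).re⌉₊)
    (hL : DiffContOnCl ℂ L (ball z₀ r)) (hM : ∀ z ∈ closedBall z₀ r, ‖L z‖ ≤ M)
    (hs : 0 < s) (hr : 0 < r) (hsr : 2 * (5 + M) < s * r) :
    ∃ z ∈ ball z₀ r, Complex.exp (s * z) = p * Complex.exp (L z) := by
  have hs' : (0 : ℝ) < s := Nat.cast_pos.2 hs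
  have hsC : (s : ℂ) ≠ 0 := Nat.cast_ne_zero.2 hs.ne'
  obtain ⟨b, hb, hbz⟩ := exists_exp_eq_natCeil_exp_re (ζ := s * z₀)
    (by rw [← Complex.ofReal_natCast, Complex.re_ofReal_mul]; positivity)
  have hdist : ‖b / s - z₀‖ ≤ 5 / s := by
    rw [show b / s - z₀ = (b - s * z₀) / s by field_simp, norm_div, Complex.norm_natCast]
    gcongr
  obtain ⟨z, hz, hzb⟩ := exists_mem_ball_add_eq (g := (-(s : ℂ)⁻¹) • L) (a := b / s)
    (M := M / s) (hL.const_smul _) (fun z hz => by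
      rw [Pi.smul_apply, norm_smul, norm_neg, norm_inv, Complex.norm_natCast, ← div_eq_inv_mul]
      gcongr
      exact hM z hz) hr (by
      calc 2 * (‖b / s - z₀‖ + M / s) ≤ 2 * (5 / s + M / s) := by gcongr
        _ = 2 * (5 + M) / s := by ring
        _ < r := by rwa [div_lt_iff₀' hs'])
  refine ⟨z, hz, ?_⟩
  have hsz : s * z = b + L z := by
    rw [Pi.smul_apply, smul_eq_mul] at hzb
    field_simp at hzb
    linear_combination hzb
  rw [hsz, Complex.exp_add, hb, hp]

lemma frequently_exists_exp_mul_eq {K : ℂ × ℂ → ℂ} {z₀ : ℂ} (hz₀ : 0 < z₀.re)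
    (hK : AnalyticAt ℂ K (0, z₀)) (hK₀ : K (0, z₀) ≠ 0) {ε : ℝ} (hε : 0 < ε) :
    ∃ᶠ p : ℕ in atTop, ∃ s : ℕ, 1 ≤ s ∧ ∃ z ∈ ball z₀ ε,
      Complex.exp (s * z) = p * K ((p : ℂ)⁻¹, z) := by
  obtain ⟨L, hL, hLK⟩ := exists_analyticAt_exp_eventuallyEq hK hK₀
  set M : ℝ := ‖L (0, z₀)‖ + 1
  have hnear : ∀ᶠ x in 𝓝 ((0, z₀) : ℂ × ℂ),
      DifferentiableAt ℂ L x ∧ ‖L x‖ < M ∧ Complex.exp (L x) = K x :=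
    (hL.eventually_analyticAt.mono fun _ h => h.differentiableAt).and
      ((hL.continuousAt.norm.eventually (gt_mem_nhds (lt_add_one _))).and hLK)
  obtain ⟨⟨δ, R⟩, ⟨hδ, hR⟩, hbox⟩ :=
    ((nhds_basis_ball.prod_nhds nhds_basis_ball).eventually_iff).1 hnear
  obtain ⟨r, hr, hrR, hrε⟩ : ∃ r, 0 < r ∧ r < R ∧ r ≤ ε :=
    ⟨min (R / 2) ε, by positivity, (min_le_left _ _).trans_lt (half_lt_self hR), min_le_right _ _⟩
  have hp_tendsto : Tendsto (fun s : ℕ => ⌈Real.exp (s * z₀).re⌉₊) atTop atTop := by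
    have hre : Tendsto (fun s : ℕ => ((s : ℂ) * z₀).re) atTop atTop := by
      simpa [Complex.mul_re] using tendsto_natCast_atTop_atTop.atTop_mul_const hz₀
    exact tendsto_nat_ceil_atTop.comp (Real.tendsto_exp_atTop.comp hre)
  have hsmall : ∀ᶠ p : ℕ in atTop, (p : ℂ)⁻¹ ∈ ball 0 δ :=
    (tendsto_inv_atTop_nhds_zero_nat (𝕜 := ℂ)).eventually (ball_mem_nhds 0 hδ)
  have hlarge : ∀ᶠ s : ℕ in atTop, 2 * (5 + M) < s * r :=
    (tendsto_natCast_atTop_atTop.atTop_mul_const hr).eventually_gt_atTop _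
  refine hp_tendsto.frequently (Eventually.frequently ?_)
  filter_upwards [hp_tendsto.eventually hsmall, hlarge, eventually_ge_atTop 1] with s hps hsr hs
  set p := ⌈Real.exp (s * z₀).re⌉₊ with hp
  have hbox' : ∀ z ∈ closedBall z₀ r, _ := fun z hz =>
    hbox (x := ((p : ℂ)⁻¹, z)) ⟨hps, closedBall_subset_ball hrR hz⟩
  have hdiff : DifferentiableOn ℂ (fun z => L ((p : ℂ)⁻¹, z)) (closedBall z₀ r) := fun z hz =>
    ((hbox' z hz).1.comp z (by fun_prop)).differentiableWithinAt
  obtain ⟨z, hz, hexp⟩ := exists_exp_mul_eq_natCast_mul_exp hz₀.le hp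
    (hdiff.mono closure_ball_subset_closedBall).diffContOnCl
    (fun z hz => (hbox' z hz).2.1.le) hs hr hsr
  exact ⟨s, hs, z, ball_subset_ball hrε hz,
    by rw [hexp, (hbox' z (ball_subset_closedBall hz)).2.2]⟩

lemma exp_ne_one_of_re_pos {z : ℂ} (hz : 0 < z.re) : Complex.exp z ≠ 1 := fun h => by
  have hnorm := congrArg norm h
  rw [Complex.norm_exp, norm_one] at hnorm
  exact (Real.one_lt_exp_iff.2 hz).ne' hnorm

lemma exp_sub_exp_pow_eq_of_exp_mul_eq {s p : ℕ} {z : ℂ} (hp : 1 ≤ p) (hz : 0 < z.re)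
    (h : Complex.exp (s * z) = 1 + (1 - Complex.exp z) / (Complex.exp (z / p) - 1)) :
    (Complex.exp (s * z) - Complex.exp z) ^ p =
      Complex.exp z * (Complex.exp (s * z) - 1) ^ p := by
  have hp' : (p : ℂ) ≠ 0 := Nat.cast_ne_zero.2 (by lia)
  have hroot : Complex.exp (z / p) - 1 ≠ 0 := sub_ne_zero.2 <| exp_ne_one_of_re_pos <| by
    rw [Complex.div_natCast_re]
    positivity
  have hpow : Complex.exp (z / p) ^ p = Complex.exp z := by
    rw [← Complex.exp_nat_mul, mul_div_cancel₀ _ hp']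
  have hbase : Complex.exp (s * z) - Complex.exp z =
      Complex.exp (z / p) * (Complex.exp (s * z) - 1) := by
    rw [h]
    field_simp
    ring
  rw [hbase, mul_pow, hpow]

lemma exists_exp_sub_exp_pow_eq {z₀ : ℂ} (hz₀ : 0 < z₀.re) {ε : ℝ} (hε : 0 < ε) :
    ∃ s p : ℕ, 1 ≤ s ∧ 1 ≤ p ∧ ∃ z ∈ ball z₀ ε, 0 < z.re ∧
      (Complex.exp (s * z) - Complex.exp z) ^ p =
        Complex.exp z * (Complex.exp (s * z) - 1) ^ p := by
  -- The right-hand side of the hypothesis of `exp_sub_exp_pow_eq_of_exp_mul_eq` is `p * K (p⁻¹, z)`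
  -- with `K (t, z) = t + (1 - e ^ z) / (z φ (t z))` and `φ u = (e ^ u - 1) / u`.
  set φ : ℂ → ℂ := dslope Complex.exp 0 with hφ
  have hφ_mul (u : ℂ) : u * φ u = Complex.exp u - 1 := by
    simpa using sub_smul_dslope Complex.exp 0 u
  have hφ_zero : φ 0 = 1 := by simp [hφ]
  have hφ_an : Differentiable ℂ φ := fun u =>
    ((Complex.differentiableOn_dslope univ_mem).2 Complex.differentiable_exp.differentiableOn
      ).differentiableAt univ_mem
  set K : ℂ × ℂ → ℂ := fun x => x.1 + (1 - Complex.exp x.2) / (x.2 * φ (x.1 * x.2)) with hK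
  have hz₀_ne : z₀ ≠ 0 := by
    rintro rfl
    simp at hz₀
  have hK_an : AnalyticAt ℂ K (0, z₀) := by
    have hφ_comp : AnalyticAt ℂ (fun x : ℂ × ℂ => φ (x.1 * x.2)) (0, z₀) :=
      (hφ_an.analyticAt _).fun_comp (analyticAt_fst.mul analyticAt_snd)
    refine analyticAt_fst.add ((analyticAt_const.sub analyticAt_snd.cexp).div
      (analyticAt_snd.mul hφ_comp) ?_)
    simpa [hφ_zero]
  have hK_ne : K (0, z₀) ≠ 0 := by
    simpa [hK, hφ_zero, hz₀_ne, sub_eq_zero] using (exp_ne_one_of_re_pos hz₀).symm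
  obtain ⟨p, ⟨s, hs, z, hz, hexp⟩, hp⟩ := ((frequently_exists_exp_mul_eq hz₀ hK_an hK_ne
    (lt_min hε hz₀)).and_eventually (eventually_ge_atTop 1)).exists
  have hp' : (p : ℂ) ≠ 0 := Nat.cast_ne_zero.2 (by lia)
  have hz_re : 0 < z.re := by
    have hdist := (mem_ball_iff_norm.1 hz).trans_le (min_le_right _ _)
    have hre := (Complex.abs_re_le_norm _).trans_lt hdist
    rw [Complex.sub_re] at hre
    linarith [(abs_lt.1 hre).1]
  refine ⟨s, p, hs, hp, z, ball_subset_ball (min_le_left _ _) hz, hz_re,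
    exp_sub_exp_pow_eq_of_exp_mul_eq hp hz_re ?_⟩
  rw [hexp, hK, ← hφ_mul (z / p)]
  simp only [inv_mul_eq_div]
  field_simp

end Analysis

section EdgeInduced

open Graph Set

variable {α β : Type*} {G : Graph α β} {F F' : Set β}

/-- The subgraph of `G` whose edges are those in `F` and whose vertices are the ends of these
edges. -/
def edgeInduced (G : Graph α β) (F : Set β) : Graph α β :=
  (G.restrict F).induce {v | ∃ e ∈ F, G.Inc e v}

lemma vertexSet_edgeInduced (G : Graph α β) (F : Set β) :
    V(edgeInduced G F) = {v | ∃ e ∈ F, G.Inc e v} := rfl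

lemma edgeSet_edgeInduced (G : Graph α β) (F : Set β) : E(edgeInduced G F) = E(G) ∩ F := by
  ext e
  constructor
  · rintro ⟨x, y, h, -⟩
    exact h.edge_mem
  · rintro ⟨he, heF⟩
    obtain ⟨x, y, h⟩ := exists_isLink_of_mem_edgeSet he
    exact ⟨x, y, ⟨heF, h⟩, ⟨e, heF, h.inc_left⟩, ⟨e, heF, h.inc_right⟩⟩

lemma inc_edgeInduced {e : β} {v : α} : (edgeInduced G F).Inc e v ↔ e ∈ F ∧ G.Inc e v := by
  constructor
  · rintro ⟨w, ⟨he, h⟩, -⟩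
    exact ⟨he, w, h⟩
  · rintro ⟨he, w, h⟩
    exact ⟨w, ⟨he, h⟩, ⟨e, he, h.inc_left⟩, ⟨e, he, h.inc_right⟩⟩

lemma edgeInduced_le : edgeInduced G F ≤ G where
  vertexSet_mono := fun _ ⟨_, _, h⟩ => h.vertex_mem
  isLink_mono := fun _ _ _ h => h.1.2

lemma edgeInduced_mono (h : F ⊆ F') : edgeInduced G F ≤ edgeInduced G F' := by
  refine (Compatible.of_le_le edgeInduced_le edgeInduced_le).le_iff.2 ⟨?_, ?_⟩
  · rintro v ⟨e, he, hev⟩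
    exact ⟨e, h he, hev⟩
  · rw [edgeSet_edgeInduced, edgeSet_edgeInduced]
    exact inter_subset_inter_right _ h

lemma edgeInduced_singleton {e : β} {x y : α} (h : G.IsLink e x y) :
    edgeInduced G {e} = banana x y {e} := by
  have hinc (v : α) : G.Inc e v ↔ v = x ∨ v = y := by
    refine ⟨fun hv => hv.eq_or_eq_of_isLink h, ?_⟩
    rintro (rfl | rfl)
    exacts [h.inc_left, h.inc_right]
  refine Graph.ext_inc ?_ fun f v => ?_
  · ext v
    simp only [vertexSet_edgeInduced, mem_singleton_iff, exists_eq_left, mem_ofPred_eq, hinc,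
      vertexSet_banana, mem_insert_iff]
  · rw [inc_edgeInduced, banana_inc, mem_singleton_iff]
    exact and_congr_right fun hf => hf ▸ hinc v

lemma isEdgeDisjointUnion_edgeInduced (h : Disjoint F F') :
    (edgeInduced G (F ∪ F')).IsEdgeDisjointUnion (edgeInduced G F) (edgeInduced G F') where
  left_le := edgeInduced_mono subset_union_left
  right_le := edgeInduced_mono subset_union_right
  vertexSet_eq := by
    ext v
    simp only [vertexSet_edgeInduced, mem_union, mem_ofPred_eq, or_and_right, exists_or]
  edgeSet_eq := by simp only [edgeSet_edgeInduced, inter_union_distrib_left]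
  disjoint := by
    simp only [edgeSet_edgeInduced]
    exact h.mono inter_subset_right inter_subset_right

end EdgeInduced

section PathColoring

variable {C : Type*} {s : ℕ}

/-- The proper colourings, with colours in `C`, of the path with vertices `0, …, s` whose ends `0`
and `s` have the colours `a` and `b`. -/
abbrev PathColoring (s : ℕ) (a b : C) : Type _ :=
  {d : Fin (s + 1) → C // (∀ j : Fin s, d j.castSucc ≠ d j.succ) ∧ d 0 = a ∧ d (Fin.last s) = b}

/-- The equivalence removing the vertex `0` from a coloured path. -/
def pathColoringSuccEquiv (a b : C) :
    PathColoring (s + 1) a b ≃ Σ c : {c : C // c ≠ a}, PathColoring s c.1 b where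
  toFun d := ⟨⟨d.1 1, fun h => d.2.1 0 (d.2.2.1.trans h.symm)⟩,
    ⟨fun j => d.1 j.succ, fun j => d.2.1 j.succ, rfl, d.2.2.2⟩⟩
  invFun x := ⟨Fin.cons a x.2.1,
    Fin.cases (fun h => x.1.2 (x.2.2.2.1.symm.trans h.symm)) x.2.2.1, rfl, x.2.2.2.2⟩
  left_inv d := Subtype.ext (funext (Fin.cases d.2.2.1.symm fun _ => rfl))
  right_inv := by
    rintro ⟨⟨c, hc⟩, d, hd, h0, hb⟩
    dsimp only at h0
    subst h0
    rfl

lemma card_pathColoring_zero [DecidableEq C] (a b : C) :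
    Nat.card (PathColoring 0 a b) = if a = b then 1 else 0 := by
  split_ifs with h
  · subst h
    refine Nat.card_eq_one_iff_unique.2 ⟨⟨fun d d' => Subtype.ext (funext fun j => ?_)⟩,
      ⟨⟨fun _ => a, fun j => j.elim0, rfl, rfl⟩⟩⟩
    rw [Fin.eq_zero j, d.2.2.1, d'.2.2.1]
  · have : IsEmpty (PathColoring 0 a b) := ⟨fun d => h (d.2.2.1.symm.trans d.2.2.2)⟩
    exact Nat.card_of_isEmpty

variable [Fintype C]

lemma card_pathColoring_succ_add (a b : C) :
    Nat.card (PathColoring (s + 1) a b) + Nat.card (PathColoring s a b) =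
      ∑ c, Nat.card (PathColoring s c b) := by
  classical
  rw [Nat.card_congr (pathColoringSuccEquiv a b), Nat.card_sigma,
    ← Finset.sum_erase_add _ _ (Finset.mem_univ a),
    Finset.sum_subtype (p := (· ≠ a)) (Finset.univ.erase a) (by simp)]

lemma sum_card_pathColoring (b : C) :
    ∑ a, (Nat.card (PathColoring s a b) : ℤ) = (Fintype.card C - 1) ^ s := by
  classical
  induction s with
  | zero => simp [card_pathColoring_zero, -Nat.card_eq_fintype_card]
  | succ s ih =>
    have hsucc (a : C) : (Nat.card (PathColoring (s + 1) a b) : ℤ) =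
        (Fintype.card C - 1) ^ s - Nat.card (PathColoring s a b) := by
      rw [← ih, eq_sub_iff_add_eq]
      exact_mod_cast card_pathColoring_succ_add a b
    simp only [hsucc, Finset.sum_sub_distrib, ih, Finset.sum_const, Finset.card_univ, nsmul_eq_mul]
    ring

lemma card_mul_card_pathColoring [DecidableEq C] (a b : C) :
    (Fintype.card C : ℤ) * Nat.card (PathColoring s a b) =
      (Fintype.card C - 1) ^ s + (-1) ^ s * if a = b then (Fintype.card C : ℤ) - 1 else -1 := by
  induction s with
  | zero =>
    rw [card_pathColoring_zero]
    split_ifs <;> simp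
  | succ s ih =>
    have hsucc : (Nat.card (PathColoring (s + 1) a b) : ℤ) + Nat.card (PathColoring s a b) =
        (Fintype.card C - 1) ^ s := by
      rw [← sum_card_pathColoring b]
      exact_mod_cast card_pathColoring_succ_add a b
    linear_combination (Fintype.card C : ℤ) * hsucc - ih

lemma sum_ite_eq_add_card_sub_one_mul [DecidableEq C] {R : Type*} [CommRing R] (a : C) (x y : R) :
    ∑ b, (if a = b then x else y) = x + (Fintype.card C - 1) * y := by
  have hsplit (b : C) : (if a = b then x else y) = (if a = b then x - y else 0) + y := by
    split_ifs <;> ring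
  simp only [hsplit, Finset.sum_add_distrib, Finset.sum_ite_eq, Finset.mem_univ, if_true,
    Finset.sum_const, Finset.card_univ, nsmul_eq_mul]
  ring

lemma card_pow_mul_sum_card_pathColoring_pow (s p : ℕ) :
    (Fintype.card C : ℤ) ^ p * ∑ a : C, ∑ b : C, (Nat.card (PathColoring s a b) : ℤ) ^ p =
      Fintype.card C * (((Fintype.card C - 1) ^ s + (-1) ^ s * (Fintype.card C - 1)) ^ p +
        (Fintype.card C - 1) * ((Fintype.card C - 1) ^ s - (-1) ^ s) ^ p) := by
  classical
  simp only [Finset.mul_sum, ← mul_pow, card_mul_card_pathColoring, mul_ite, add_ite, ite_pow,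
    sum_ite_eq_add_card_sub_one_mul, Finset.sum_const, Finset.card_univ, nsmul_eq_mul, mul_neg_one,
    ← sub_eq_add_neg]

end PathColoring

section Theta

open Graph Set

variable {s p : ℕ}

lemma thetaNode_zero (s i : ℕ) : thetaNode s i 0 = .left := rfl

lemma thetaNode_self (hs : 1 ≤ s) (i : ℕ) : thetaNode s i s = .right := by
  rw [thetaNode, if_neg (by lia), if_pos rfl]

lemma thetaNode_of_lt {i j : ℕ} (hj : 0 < j) (hjs : j < s) : thetaNode s i j = .inner i j := by
  rw [thetaNode, if_neg hj.ne', if_neg hjs.ne]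

lemma thetaNode_eq_iff {i i' j j' : ℕ} (hs : 1 ≤ s) (hj : j ≤ s) (hj' : j' ≤ s) :
    thetaNode s i j = thetaNode s i' j' ↔ j = j' ∧ (i = i' ∨ j = 0 ∨ j = s) := by
  unfold thetaNode
  split_ifs <;> simp <;> lia

lemma vertexSet_theta (s p : ℕ) :
    V(theta s p) = {.left, .right} ∪ image2 ThetaVertex.inner (Iio p) (Ioo 0 s) := by
  ext v
  refine or_congr_right ⟨?_, ?_⟩
  · rintro ⟨i, j, hi, hj, hjs, rfl⟩
    exact mem_image2_of_mem hi ⟨hj, hjs⟩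
  · rintro ⟨i, hi, j, ⟨hj, hjs⟩, rfl⟩
    exact ⟨i, j, hi, hj, hjs, rfl⟩

lemma vertexSet_theta_eq_image2_thetaNode (hs : 1 ≤ s) (hp : 1 ≤ p) :
    V(theta s p) = image2 (thetaNode s) (Iio p) (Iic s) := by
  rw [vertexSet_theta]
  refine Subset.antisymm (union_subset ?_ ?_) ?_
  · rintro v (rfl | rfl)
    · exact ⟨0, hp, 0, s.zero_le, rfl⟩
    · exact ⟨0, hp, s, mem_Iic.2 le_rfl, thetaNode_self hs 0⟩
  · rintro _ ⟨i, hi, j, ⟨hj, hjs⟩, rfl⟩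
    exact ⟨i, hi, j, hjs.le, thetaNode_of_lt hj hjs⟩
  · rintro _ ⟨i, hi, j, hj, rfl⟩
    unfold thetaNode
    split_ifs with h0 hjs
    · exact .inl (.inl rfl)
    · exact .inl (.inr rfl)
    · exact .inr (mem_image2_of_mem hi ⟨Nat.pos_of_ne_zero h0, lt_of_le_of_ne hj hjs⟩)

lemma edgeSet_theta (s p : ℕ) : E(theta s p) = Iio p ×ˢ Iio s := rfl

lemma finite_vertexSet_theta (s p : ℕ) : V(theta s p).Finite := by
  rw [vertexSet_theta]
  exact (toFinite _).union ((finite_Iio p).image2 _ (finite_Ioo 0 s))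

lemma finite_edgeSet_theta (s p : ℕ) : E(theta s p).Finite :=
  (finite_Iio p).prod (finite_Iio s)

lemma ncard_vertexSet_theta (s p : ℕ) : V(theta s p).ncard = 2 + p * (s - 1) := by
  have hdisj : Disjoint {.left, .right} (image2 ThetaVertex.inner (Iio p) (Ioo 0 s)) := by
    rw [disjoint_left]
    rintro v (rfl | rfl) ⟨i, -, j, -, h⟩ <;> cases h
  have hinj : Function.Injective (Function.uncurry ThetaVertex.inner) := by
    rintro ⟨i, j⟩ ⟨i', j'⟩ h
    simpa using h
  rw [vertexSet_theta, ncard_union_eq hdisj (toFinite _) ((finite_Iio p).image2 _ (finite_Ioo 0 s)),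
    ncard_pair (by simp), ← image_uncurry_prod, ncard_image_of_injective _ hinj, ncard_prod]
  simp [← Nat.card_coe_set_eq]

lemma ncard_edgeSet_theta (s p : ℕ) : E(theta s p).ncard = p * s := by
  rw [edgeSet_theta, ncard_prod]
  simp [← Nat.card_coe_set_eq]

lemma eq_and_eq_of_isomorphic_theta {s' p' : ℕ} (hs : 1 ≤ s) (hp : 1 ≤ p) (hs' : 1 ≤ s')
    (h : (theta s p).Isomorphic (theta s' p')) : s = s' ∧ p = p' := by
  obtain ⟨f, g, -⟩ := h
  have hV : 2 + p * (s - 1) = 2 + p' * (s' - 1) := by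
    simpa only [Nat.card_coe_set_eq, ncard_vertexSet_theta] using Nat.card_congr f
  have hE : p * s = p' * s' := by
    simpa only [Nat.card_coe_set_eq, ncard_edgeSet_theta] using Nat.card_congr g
  have hp_eq : p = p' := by
    obtain ⟨a, rfl⟩ := Nat.exists_eq_add_of_le' hs
    obtain ⟨b, rfl⟩ := Nat.exists_eq_add_of_le' hs'
    rw [mul_add, mul_add] at hE
    simp only [Nat.add_sub_cancel] at hV
    lia
  subst hp_eq
  exact ⟨Nat.eq_of_mul_eq_mul_left hp hE, rfl⟩

/-- The point with abscissa `t` on the parabola arc `y = i x (1 - x)`, along which the `i`-th path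
of a theta graph is drawn. -/
noncomputable def thetaPoint (i : ℕ) (t : ℝ) : ℝ × ℝ := (t, i * (t * (1 - t)))

/-- The drawing of the vertices of `theta s p` in the plane: the `j`-th vertex of a path has
abscissa `j / s`. -/
noncomputable def thetaPosition (s : ℕ) : ThetaVertex → ℝ × ℝ
  | .left => (0, 0)
  | .right => (1, 0)
  | .inner i j => thetaPoint i (j / s)

lemma continuous_thetaPoint (i : ℕ) : Continuous (thetaPoint i) := by
  unfold thetaPoint
  fun_prop

lemma thetaPoint_eq_iff {i i' : ℕ} {t t' : ℝ} (ht : t ∈ Ioo 0 1) :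
    thetaPoint i t = thetaPoint i' t' ↔ i = i' ∧ t = t' := by
  refine ⟨fun h => ?_, by rintro ⟨rfl, rfl⟩; rfl⟩
  obtain ⟨rfl, h⟩ := Prod.mk.inj h
  have hne : t * (1 - t) ≠ 0 := (mul_pos ht.1 (sub_pos.2 ht.2)).ne'
  exact ⟨by exact_mod_cast mul_right_cancel₀ hne h, rfl⟩

lemma thetaPosition_thetaNode (hs : 1 ≤ s) (i j : ℕ) :
    thetaPosition s (thetaNode s i j) = thetaPoint i (j / s) := by
  have hs' : (s : ℝ) ≠ 0 := Nat.cast_ne_zero.2 (by lia)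
  unfold thetaNode
  split_ifs with h0 h1
  · simp [thetaPosition, thetaPoint, h0]
  · simp [thetaPosition, thetaPoint, h1, hs']
  · rfl

lemma injOn_thetaPosition (hs : 1 ≤ s) (hp : 1 ≤ p) : InjOn (thetaPosition s) V(theta s p) := by
  have hs' : (0 : ℝ) < s := Nat.cast_pos.2 hs
  rw [vertexSet_theta_eq_image2_thetaNode hs hp]
  rintro _ ⟨i, -, j, hj, rfl⟩ _ ⟨i', -, j', hj', rfl⟩ h
  rw [thetaPosition_thetaNode hs, thetaPosition_thetaNode hs] at h
  rw [thetaNode_eq_iff hs hj hj']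
  obtain rfl : j = j' := by
    exact_mod_cast (div_left_inj' hs'.ne').1 (congrArg Prod.fst h)
  refine ⟨rfl, or_iff_not_imp_right.2 fun hends => ?_⟩
  push Not at hends
  refine ((thetaPoint_eq_iff ⟨?_, ?_⟩).1 h).1
  · exact div_pos (Nat.cast_pos.2 (Nat.pos_of_ne_zero hends.1)) hs'
  · rw [div_lt_one hs']
    exact_mod_cast lt_of_le_of_ne hj hends.2

lemma thetaPoint_div_eq_iff {i i' j j' : ℕ} {r r' : ℝ} (hj : j < s) (hr : r ∈ Ioo 0 1)
    (hr' : r' ∈ Ico 0 1) :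
    thetaPoint i ((j + r) / s) = thetaPoint i' ((j' + r') / s) ↔ i = i' ∧ j = j' ∧ r = r' := by
  have hs' : (0 : ℝ) < s := Nat.cast_pos.2 (j.zero_le.trans_lt hj)
  have hj' : (j : ℝ) + 1 ≤ s := by exact_mod_cast hj
  have hmem : (j + r) / s ∈ Ioo (0 : ℝ) 1 :=
    ⟨div_pos (add_pos_of_nonneg_of_pos j.cast_nonneg hr.1) hs',
      (div_lt_one hs').2 (by linarith [hr.2])⟩
  rw [thetaPoint_eq_iff hmem, div_left_inj' hs'.ne']
  refine and_congr_right fun _ => ⟨fun h => ?_, by rintro ⟨rfl, rfl⟩; rfl⟩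
  have hfloor := congrArg Nat.floor h
  rw [add_comm, Nat.floor_add_natCast hr.1.le, add_comm (j' : ℝ), Nat.floor_add_natCast hr'.1,
    Nat.floor_eq_zero.2 hr.2, Nat.floor_eq_zero.2 hr'.2, zero_add, zero_add] at hfloor
  subst hfloor
  exact ⟨rfl, add_left_cancel h⟩

lemma isPlanar_theta (hs : 1 ≤ s) (hp : 1 ≤ p) : (theta s p).IsPlanar := by
  refine ⟨thetaPosition s, fun e r => thetaPoint e.1 ((e.2 + r) / s),
    injOn_thetaPosition hs hp, ?_, ?_, ?_, ?_, ?_⟩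
  · exact fun e _ => ((continuous_thetaPoint e.1).comp (by fun_prop)).continuousOn
  · rintro e u v ⟨-, -, h⟩
    simpa [thetaPosition_thetaNode hs] using (congrArg (Sym2.map (thetaPosition s)) h).symm
  · intro e he r hr r' hr' h
    exact ((thetaPoint_div_eq_iff he.2 hr (Ioo_subset_Ico_self hr')).1 h).2.2
  · intro e he
    rw [vertexSet_theta_eq_image2_thetaNode hs hp, disjoint_left]
    rintro _ ⟨r, hr, rfl⟩ ⟨_, ⟨i, -, j, -, rfl⟩, h⟩
    rw [thetaPosition_thetaNode hs, ← add_zero (j : ℝ)] at h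
    exact hr.1.ne' ((thetaPoint_div_eq_iff he.2 hr (left_mem_Ico.2 one_pos)).1 h.symm).2.2
  · intro e he f _ hef
    rw [disjoint_left]
    rintro _ ⟨r, hr, rfl⟩ ⟨r', hr', h⟩
    obtain ⟨hi, hj, -⟩ := (thetaPoint_div_eq_iff he.2 hr (Ioo_subset_Ico_self hr')).1 h.symm
    exact hef (Prod.ext hi hj)

lemma inc_theta {e : ℕ × ℕ} {v : ThetaVertex} : (theta s p).Inc e v ↔
    (e.1 < p ∧ e.2 < s) ∧ (v = thetaNode s e.1 e.2 ∨ v = thetaNode s e.1 (e.2 + 1)) := by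
  constructor
  · rintro ⟨w, hi, hj, h⟩
    rcases Sym2.eq_iff.1 h with ⟨rfl, rfl⟩ | ⟨rfl, rfl⟩
    exacts [⟨⟨hi, hj⟩, .inl rfl⟩, ⟨⟨hi, hj⟩, .inr rfl⟩]
  · rintro ⟨⟨hi, hj⟩, rfl | rfl⟩
    exacts [⟨_, hi, hj, rfl⟩, ⟨_, hi, hj, Sym2.eq_swap⟩]

lemma vertexSet_edgeInduced_theta {I : Set ℕ} {a b : ℕ} (hI : I ⊆ Iio p) (hab : a < b)
    (hb : b ≤ s) :
    V(edgeInduced (theta s p) (I ×ˢ Ico a b)) = image2 (thetaNode s) I (Icc a b) := by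
  ext v
  simp only [vertexSet_edgeInduced, mem_ofPred_eq, inc_theta]
  constructor
  · rintro ⟨⟨i, j⟩, ⟨hi, haj, hjb⟩, -, rfl | rfl⟩
    exacts [⟨i, hi, j, ⟨haj, hjb.le⟩, rfl⟩, ⟨i, hi, j + 1, ⟨haj.trans j.le_succ, hjb⟩, rfl⟩]
  · rintro ⟨i, hi, j, ⟨haj, hjb⟩, rfl⟩
    rcases hjb.lt_or_eq with hjb | rfl
    · exact ⟨(i, j), ⟨hi, haj, hjb⟩, ⟨hI hi, hjb.trans_le hb⟩, .inl rfl⟩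
    · obtain ⟨k, rfl⟩ := Nat.exists_eq_add_of_lt hab
      exact ⟨(i, a + k), ⟨hi, by simp⟩, ⟨hI hi, hb⟩, .inr rfl⟩

lemma edgeInduced_theta_eq_self (hs : 1 ≤ s) (hp : 1 ≤ p) :
    edgeInduced (theta s p) (Iio p ×ˢ Ico 0 s) = theta s p := by
  have hE : E(edgeInduced (theta s p) (Iio p ×ˢ Ico 0 s)) = E(theta s p) := by
    rw [edgeSet_edgeInduced, edgeSet_theta, ← Nat.bot_eq_zero, Ico_bot, inter_self]
  have hV : V(edgeInduced (theta s p) (Iio p ×ˢ Ico 0 s)) = V(theta s p) := by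
    rw [vertexSet_edgeInduced_theta subset_rfl hs le_rfl, vertexSet_theta_eq_image2_thetaNode hs hp,
      ← Nat.bot_eq_zero, Icc_bot]
  exact (Compatible.of_le edgeInduced_le).ext hV hE

lemma isSeriesParallel_edge_theta {i j : ℕ} (hi : i < p) (hj : j < s) :
    (edgeInduced (theta s p) ({i} ×ˢ Ico j (j + 1))).IsSeriesParallel
      (thetaNode s i j) (thetaNode s i (j + 1)) := by
  rw [Ico_add_one_right_eq_Icc, Icc_self, singleton_prod_singleton,
    edgeInduced_singleton (G := theta s p) ⟨hi, hj, rfl⟩]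
  refine .edge _ _ _ fun h => ?_
  have := (thetaNode_eq_iff (by lia) hj.le hj).1 h
  lia

lemma isSeriesParallel_path_theta {i a b : ℕ} (hi : i < p) (hab : a < b) (hb : b ≤ s) :
    (edgeInduced (theta s p) ({i} ×ˢ Ico a b)).IsSeriesParallel
      (thetaNode s i a) (thetaNode s i b) := by
  have hI : {i} ⊆ Iio p := singleton_subset_iff.2 hi
  induction b, hab using Nat.le_induction with
  | base => exact isSeriesParallel_edge_theta hi hb
  | succ b hab ih =>
    have hunion : ({i} ×ˢ Ico a (b + 1) : Set (ℕ × ℕ)) =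
        {i} ×ˢ Ico a b ∪ {i} ×ˢ Ico b (b + 1) := by
      rw [← prod_union, Ico_union_Ico_eq_Ico (by lia) b.le_succ]
    have hdisj : Disjoint ({i} ×ˢ Ico a b : Set (ℕ × ℕ)) ({i} ×ˢ Ico b (b + 1)) :=
      disjoint_prod.2 (.inr (Ico_disjoint_Ico_same))
    rw [hunion]
    refine .series _ _ _ _ _ _ (isEdgeDisjointUnion_edgeInduced hdisj) ?_ (ih (by lia))
      (isSeriesParallel_edge_theta hi hb)
    rw [vertexSet_edgeInduced_theta hI hab (by lia),
      vertexSet_edgeInduced_theta hI b.lt_succ_self hb]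
    refine Subset.antisymm ?_ (singleton_subset_iff.2 ⟨⟨i, rfl, b, ⟨by lia, le_rfl⟩, rfl⟩,
      ⟨i, rfl, b, ⟨le_rfl, by lia⟩, rfl⟩⟩)
    rintro _ ⟨⟨_, rfl, j, hj, rfl⟩, ⟨_, rfl, j', hj', h⟩⟩
    obtain ⟨rfl, -⟩ := (thetaNode_eq_iff (by lia) (hj'.2.trans hb) (hj.2.trans (by lia))).1 h
    rw [mem_singleton_iff, le_antisymm hj.2 hj'.1]

lemma isSeriesParallel_paths_theta (hs : 1 ≤ s) {m : ℕ} (hm : 1 ≤ m) (hmp : m ≤ p) :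
    (edgeInduced (theta s p) (Iio m ×ˢ Ico 0 s)).IsSeriesParallel .left .right := by
  have hpath {i : ℕ} (hi : i < p) :
      (edgeInduced (theta s p) ({i} ×ˢ Ico 0 s)).IsSeriesParallel .left .right := by
    simpa only [thetaNode_zero, thetaNode_self hs] using isSeriesParallel_path_theta hi hs le_rfl
  induction m, hm using Nat.le_induction with
  | base => simpa using hpath hmp
  | succ m hm ih =>
    have hunion : Iio (m + 1) ×ˢ Ico 0 s = Iio m ×ˢ Ico 0 s ∪ {m} ×ˢ Ico 0 s := by
      rw [← union_prod, ← Order.succ_eq_add_one, Order.Iio_succ_eq_insert, insert_eq, union_comm]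
    have hdisj : Disjoint (Iio m ×ˢ Ico 0 s) ({m} ×ˢ Ico 0 s) :=
      disjoint_prod.2 (.inl (by simp))
    rw [hunion]
    refine .parallel _ _ _ _ _ (isEdgeDisjointUnion_edgeInduced hdisj) ?_ (ih (by lia)) (hpath hmp)
    rw [vertexSet_edgeInduced_theta (Iio_subset_Iio (by lia)) hs le_rfl,
      vertexSet_edgeInduced_theta (singleton_subset_iff.2 hmp) hs le_rfl]
    refine Subset.antisymm ?_ ?_
    · rintro _ ⟨⟨i, hi, j, hj, rfl⟩, ⟨_, rfl, j', hj', h⟩⟩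
      obtain ⟨rfl, rfl | rfl | rfl⟩ := (thetaNode_eq_iff hs hj'.2 hj.2).1 h
      · exact absurd hi self_notMem_Iio
      · exact .inl rfl
      · exact .inr (thetaNode_self hs i)
    · rintro v (rfl | rfl)
      · exact ⟨⟨0, hm, 0, by simp, rfl⟩, ⟨m, rfl, 0, by simp, rfl⟩⟩
      · exact ⟨⟨0, hm, s, by simp, thetaNode_self hs 0⟩, ⟨m, rfl, s, by simp, thetaNode_self hs m⟩⟩

lemma isSeriesParallel_theta (hs : 1 ≤ s) (hp : 1 ≤ p) :
    (theta s p).IsSeriesParallel .left .right := by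
  simpa only [edgeInduced_theta_eq_self hs hp] using isSeriesParallel_paths_theta hs hp le_rfl

lemma thetaNode_mem_vertexSet_theta (hs : 1 ≤ s) {i j : ℕ} (hi : i < p) (hj : j ≤ s) :
    thetaNode s i j ∈ V(theta s p) := by
  rw [vertexSet_theta_eq_image2_thetaNode hs (i.zero_le.trans_lt hi)]
  exact mem_image2_of_mem hi hj

lemma left_mem_vertexSet_theta (s p : ℕ) : ThetaVertex.left ∈ V(theta s p) := .inl (.inl rfl)

lemma right_mem_vertexSet_theta (s p : ℕ) : ThetaVertex.right ∈ V(theta s p) := .inl (.inr rfl)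

section Coloring

variable {C : Type*} {k : ℕ}

/-- The vertex colouring of a theta graph glued from colourings of its paths that agree at the
two ends; labels that are not vertices of the graph get the colour `a`. -/
def glueThetaColoring {a b : C} (d : Fin p → PathColoring s a b) : ThetaVertex → C
  | .left => a
  | .right => b
  | .inner i j => if h : i < p ∧ j < s + 1 then (d ⟨i, h.1⟩).1 ⟨j, h.2⟩ else a

lemma glueThetaColoring_thetaNode {a b : C} (d : Fin p → PathColoring s a b) (i : Fin p)
    (j : Fin (s + 1)) : glueThetaColoring d (thetaNode s i j) = (d i).1 j := by
  unfold thetaNode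
  split_ifs with h0 hjs
  · obtain rfl : j = 0 := Fin.ext h0
    exact (d i).2.2.1.symm
  · obtain rfl : j = Fin.last s := Fin.ext hjs
    exact (d i).2.2.2.symm
  · exact dif_pos ⟨i.2, j.2⟩

lemma glueThetaColoring_ne {a b : C} (d : Fin p → PathColoring s a b) {e : ℕ × ℕ}
    {u v : ThetaVertex} (h : (theta s p).IsLink e u v) :
    glueThetaColoring d u ≠ glueThetaColoring d v := by
  obtain ⟨hi, hj, huv⟩ := h
  have hne := (d ⟨e.1, hi⟩).2.1 ⟨e.2, hj⟩
  rw [← glueThetaColoring_thetaNode, ← glueThetaColoring_thetaNode] at hne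
  rcases Sym2.eq_iff.1 huv with ⟨rfl, rfl⟩ | ⟨rfl, rfl⟩
  exacts [hne, hne.symm]

/-- The colours of the two end vertices of a coloured theta graph. -/
def endColors (c : (theta s p).ProperColoring k) : Fin k × Fin k :=
  (c.1 ⟨_, left_mem_vertexSet_theta s p⟩, c.1 ⟨_, right_mem_vertexSet_theta s p⟩)

/-- The equivalence restricting the proper colourings of a theta graph whose end vertices have the
colours `x.1` and `x.2` to the paths of the graph. -/
def thetaColoringEquiv (hs : 1 ≤ s) (hp : 1 ≤ p) (x : Fin k × Fin k) :
    {c : (theta s p).ProperColoring k // endColors c = x} ≃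
      (Fin p → PathColoring s x.1 x.2) where
  toFun c i :=
    ⟨fun j => c.1.1 ⟨thetaNode s i j, thetaNode_mem_vertexSet_theta hs i.2 (Nat.lt_succ_iff.1 j.2)⟩,
      fun j => c.1.2 (i, j) _ _ ⟨i.2, j.2, rfl⟩, congrArg Prod.fst c.2,
      (congrArg c.1.1 (Subtype.ext (thetaNode_self hs i))).trans (congrArg Prod.snd c.2)⟩
  invFun d := ⟨⟨fun v => glueThetaColoring d v.1, fun _ _ _ h => glueThetaColoring_ne d h⟩, rfl⟩
  left_inv c := by
    refine Subtype.ext (Subtype.ext (funext fun ⟨v, hv⟩ => ?_))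
    obtain ⟨i, hi, j, hj, rfl⟩ := (vertexSet_theta_eq_image2_thetaNode hs hp).subset hv
    dsimp only
    exact glueThetaColoring_thetaNode _ ⟨i, hi⟩ ⟨j, Nat.lt_succ_iff.2 hj⟩
  right_inv d := funext fun i => Subtype.ext (funext fun j => glueThetaColoring_thetaNode d i j)

lemma card_properColoring_theta (hs : 1 ≤ s) (hp : 1 ≤ p) :
    Nat.card ((theta s p).ProperColoring k) =
      ∑ a : Fin k, ∑ b : Fin k, Nat.card (PathColoring s a b) ^ p := by
  have := (finite_vertexSet_theta s p).to_subtype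
  have : Finite ((theta s p).ProperColoring k) :=
    inferInstanceAs (Finite {c : V(theta s p) → Fin k // _})
  rw [← Nat.card_congr (Equiv.sigmaFiberEquiv endColors), Nat.card_sigma,
    ← Fintype.sum_prod_type' (f := fun a b : Fin k => Nat.card (PathColoring s a b) ^ p)]
  refine Finset.sum_congr rfl fun x _ => ?_
  rw [Nat.card_congr (thetaColoringEquiv hs hp x), Nat.card_fun, Nat.card_fin]

end Coloring

lemma X_pow_mul_chromaticPolynomial_theta (hs : 1 ≤ s) (hp : 1 ≤ p) :
    X ^ p * (theta s p).chromaticPolynomial =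
      X * (((X - 1) ^ s + (-1) ^ s * (X - 1)) ^ p +
        (X - 1) * ((X - 1) ^ s - (-1) ^ s) ^ p) := by
  refine eq_of_infinite_eval_eq _ _
    ((infinite_range_of_injective (Nat.cast_injective (R := ℤ))).mono ?_)
  rintro _ ⟨k, rfl⟩
  have hcard := card_pow_mul_sum_card_pathColoring_pow (C := Fin k) s p
  rw [Fintype.card_fin] at hcard
  rw [mem_ofPred_eq, eval_mul, chromaticPolynomial_eval_natCast _ (finite_vertexSet_theta s p)
    (finite_edgeSet_theta s p), card_properColoring_theta hs hp]
  push_cast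
  simp only [eval_mul, eval_pow, eval_X, eval_add, eval_sub, eval_one, eval_neg, hcard]

lemma one_sub_mem_chromaticRoots_theta (hs : 1 ≤ s) (hp : 1 ≤ p) {w : ℂ} (hw : w ≠ 1)
    (h : (w ^ s - w) ^ p = w * (w ^ s - 1) ^ p) : 1 - w ∈ (theta s p).chromaticRoots := by
  have hroot := congrArg (aeval (1 - w)) (X_pow_mul_chromaticPolynomial_theta hs hp)
  simp only [map_mul, map_pow, map_add, map_sub, map_neg, map_one, aeval_X] at hroot
  refine (mul_eq_zero.1 (hroot.trans ?_)).resolve_left (pow_ne_zero _ (sub_ne_zero.2 hw.symm))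
  have hneg : (1 - w - 1) ^ s = (-1) ^ s * w ^ s := by
    rw [← mul_pow]
    ring
  have hbase_one : (1 - w - 1) ^ s + (-1) ^ s * (1 - w - 1) = (-1) ^ s * (w ^ s - w) := by
    rw [hneg]
    ring
  have hbase_two : (1 - w - 1) ^ s - (-1) ^ s = (-1) ^ s * (w ^ s - 1) := by
    rw [hneg]
    ring
  rw [hbase_one, hbase_two, mul_pow, mul_pow]
  linear_combination (1 - w) * ((-1) ^ s) ^ p * h

end Theta

section Density

open Graph Metric

lemma mem_closure_chromaticRoots_theta {q₀ : ℂ} (hq₀ : 1 < ‖q₀ - 1‖) :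
    q₀ ∈ closure {q : ℂ | ∃ s p : ℕ, 1 ≤ s ∧ 1 ≤ p ∧ q ∈ (theta s p).chromaticRoots} := by
  rw [norm_sub_rev] at hq₀
  set z₀ := Complex.log (1 - q₀) with hz₀
  have hexp : 1 - Complex.exp z₀ = q₀ := by
    rw [Complex.exp_log (norm_pos_iff.1 (one_pos.trans hq₀)), sub_sub_cancel]
  have hre : 0 < z₀.re := by
    rw [hz₀, Complex.log_re]
    exact Real.log_pos hq₀
  have hcont : ContinuousAt (fun z => 1 - Complex.exp z) z₀ := by fun_prop
  refine Metric.mem_closure_iff.2 fun ε hε => ?_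
  obtain ⟨r, hr, hball⟩ := Metric.continuousAt_iff.1 hcont ε hε
  obtain ⟨s, p, hs, hp, z, hz, hzre, heq⟩ := exists_exp_sub_exp_pow_eq hre hr
  rw [Complex.exp_nat_mul] at heq
  refine ⟨1 - Complex.exp z, ⟨s, p, hs, hp, one_sub_mem_chromaticRoots_theta hs hp
    (exp_ne_one_of_re_pos hzre) heq⟩, ?_⟩
  rw [dist_comm, ← hexp]
  exact hball hz

lemma setOf_one_le_norm_sub_one_eq_closure :
    {q : ℂ | 1 ≤ ‖q - 1‖} = closure {q : ℂ | 1 < ‖q - 1‖} := by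
  have hcompl : {q : ℂ | 1 < ‖q - 1‖} = (closedBall 1 1)ᶜ := by
    ext q
    simp [dist_eq_norm]
  rw [hcompl, closure_compl, interior_closedBall _ one_ne_zero]
  ext q
  simp [dist_eq_norm]

end Density

theorem theorem1p1 :
    (∀ s p : ℕ, 1 ≤ s → 1 ≤ p →
      (Graph.theta s p).vertexSet.Finite ∧ (Graph.theta s p).edgeSet.Finite ∧
      (Graph.theta s p).IsSeriesParallel .left .right ∧ (Graph.theta s p).IsPlanar) ∧
    (∀ s p s' p' : ℕ, 1 ≤ s → 1 ≤ p → 1 ≤ s' → 1 ≤ p' →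
      (Graph.theta s p).Isomorphic (Graph.theta s' p') → s = s' ∧ p = p') ∧
    {q : ℂ | 1 ≤ ‖q - 1‖} ⊆
      closure {q : ℂ | ∃ s p : ℕ, 1 ≤ s ∧ 1 ≤ p ∧ q ∈ (Graph.theta s p).chromaticRoots} := by
  refine ⟨fun s p hs hp => ⟨finite_vertexSet_theta s p, finite_edgeSet_theta s p,
    isSeriesParallel_theta hs hp, isPlanar_theta hs hp⟩,
    fun s p s' p' hs hp hs' _ h => eq_and_eq_of_isomorphic_theta hs hp hs' h, ?_⟩
  rw [setOf_one_le_norm_sub_one_eq_closure]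
  exact closure_minimal (fun _ hq => mem_closure_chromaticRoots_theta hq) isClosed_closure
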